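/- Let $K$ be a number field with ring of integers $\mathcal{O}_K$. For a commutative ring $R$ and an integer $n\ge 1$ let $a_n(R)$ be the number of ideals $I$ of $R$ with $|R/I| = n$, and, when these numbers are all finite, let $$\zeta(R,s) = \sum_{n\ge 1} \frac{a_n(R)}{n^s}$$ be the ideal zeta function of $R$. Let $\zeta_K = \zeta(\mathcal{O}_K,\cdot)$ be the Dedekind zeta function of $K$. Then $a_n(\mathcal{O}_K[X])$ is finite for every $n \ge 1$, and for every complex number $s$ with $\Re(s) > 2$ the series $\zeta(\mathcal{O}_K[X],s)$ converges absolutely, the infinite product $\prod_{d\ge 1}\zeta_K(d(s-1))$ converges absolutely (that is, $\sum_{d\ge1}|\zeta_K(d(s-1))-1|<\infty$), and $$\zeta(\mathcal{O}_K[X], s) = \prod_{d=1}^{\infty} \zeta_K(d(s-1)).$$ -/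

import Mathlib

open scoped NumberField Polynomial

/-- The ideals of index `n` in a commutative ring `R`. For `n ≥ 1` the condition says that the
quotient ring is finite with exactly `n` elements. -/
def idealsOfIndex (R : Type*) [CommRing R] (n : ℕ) : Set (Ideal R) :=
  {I | Nat.card (R ⧸ I) = n}

/-- The number `a_n(R)` of ideals of index `n` in `R` (meaningful when `n ≥ 1` and there are only
finitely many such ideals). -/
noncomputable def idealCount (R : Type*) [CommRing R] (n : ℕ) : ℕ :=
  (idealsOfIndex R n).ncard

/-- The ideal zeta function `ζ(R, s) = ∑_{n ≥ 1} a_n(R) / n ^ s`. (An `LSeries` disregards the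
coefficient with index `0`.) -/
noncomputable def idealZeta (R : Type*) [CommRing R] (s : ℂ) : ℂ :=
  LSeries (fun n ↦ (idealCount R n : ℂ)) s

/-- The ideal zeta function of the ring of integers is the Dedekind zeta function. -/
theorem idealZeta_ringOfIntegers (K : Type*) [Field K] [NumberField K] (s : ℂ) :
    idealZeta (𝓞 K) s = NumberField.dedekindZeta K s := rfl

open Polynomial Pointwise

/-! Write A for the ring of integers and N for index. Let I be an ideal of finite index in A[X]
containing a monic u of degree k + 1. Let a be the ideal of coefficients at X^k of elements of I of
degree at most k, and J = (I : a). Reduction with u shows that all coefficients of these elements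
lie in a. Since a is invertible, they form a • J_{≤k}, where J_{≤k} is the part of J of degree at
most k. Comparing top coefficients and cancelling a, J contains a monic polynomial of degree k, and
division by u gives I = (u) + aJ.

Conversely, any nonzero a, any J of finite index containing a monic of degree k, and any monic u in
J of degree k + 1 give such an I. It depends on u only modulo a • J_{≤k}, a submodule of index
N(a)^(k+1) in J_{≤k}. So each pair (a, J) has N(a)^(k+1) preimages I (`card_colonFiber`), all with
N(I) = N(a)^(k+1) N(J) (`card_quotient_of_mem_colonFiber`). Hence the sum of N(I)^(-s) over ideals
containing a monic of degree k + 1 is ζ_K((k+1)(s-1)) times the sum for degree k, which starts at 1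
for k = 0 (`hasSum_zetaTerm_hasMonic`).

Every ideal of finite index contains a monic polynomial, so k → ∞ exhausts them all. Convergence of
the product bounds the partial sums at real s, which gives absolute convergence, and dominated
convergence gives the identity. -/

theorem AddSubgroup.relIndex_eq_relIndex_inf_ker_mul_relIndex_map {G H : Type*} [AddCommGroup G]
    [AddCommGroup H] (f : G →+ H) {N M : AddSubgroup G} (h : N ≤ M) :
    N.relIndex M = (N ⊓ f.ker).relIndex (M ⊓ f.ker) * (N.map f).relIndex (M.map f) := by
  have h1 : (N.map f).relIndex (M.map f) = ((N ⊔ f.ker) ⊓ M).relIndex M := by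
    rw [AddSubgroup.relIndex_map_map, AddSubgroup.inf_relIndex_right,
      ← AddSubgroup.relIndex_sup_left M (N ⊔ f.ker)]
    congr 1
    rw [sup_right_comm, sup_eq_right.2 h]
  have h2 : (N ⊓ f.ker).relIndex (M ⊓ f.ker) = N.relIndex ((N ⊔ f.ker) ⊓ M) := by
    rw [sup_inf_assoc_of_le _ h, AddSubgroup.relIndex_sup_left, inf_comm f.ker M,
      ← AddSubgroup.inf_relIndex_right N (M ⊓ f.ker), ← inf_assoc, inf_eq_left.2 h]
  rw [h1, h2]
  exact (AddSubgroup.relIndex_mul_relIndex _ _ _ (le_inf le_sup_left h) inf_le_right).symm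

/-! ### Invertible ideals acting on torsion-free modules -/

section TorsionFree

variable {A V : Type*} [CommRing A] [IsDedekindDomain A] [AddCommGroup V] [Module A V]

theorem Ideal.exists_mul_eq_span_singleton {a : Ideal A} (ha : a ≠ ⊥) :
    ∃ (b : Ideal A) (x : A), x ≠ 0 ∧ a * b = Ideal.span {x} := by
  obtain ⟨x, hx, hx0⟩ := Submodule.exists_mem_ne_zero_of_ne_bot ha
  obtain ⟨b, hb⟩ := Ideal.dvd_iff_le.2 ((Ideal.span_singleton_le_iff_mem _).2 hx)
  exact ⟨b, x, hx0, hb.symm⟩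

variable [Module.IsTorsionFree A V]

/-- Multiply by a complementary ideal b with ab = (x), then cancel x by torsion-freeness. -/
theorem Submodule.mem_of_forall_smul_mem_smul {a : Ideal A} (ha : a ≠ ⊥) {M : Submodule A V}
    {f : V} (h : ∀ c ∈ a, c • f ∈ a • M) : f ∈ M := by
  obtain ⟨b, x, hx, hab⟩ := Ideal.exists_mul_eq_span_singleton ha
  have key : ∀ y ∈ a * b, y • f ∈ Ideal.span {x} • M := by
    intro y hy
    rw [← hab]
    refine Submodule.mul_induction_on hy (fun c hc d hd ↦ ?_) (fun y z hy hz ↦ ?_)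
    · rw [mul_comm c d, mul_comm a b, Submodule.mul_smul, mul_smul]
      exact Submodule.smul_mem_smul hd (h c hc)
    · rw [add_smul]
      exact add_mem hy hz
  have := key x (hab ▸ Ideal.mem_span_singleton_self x)
  rw [Submodule.ideal_span_singleton_smul] at this
  obtain ⟨m, hm, hmf⟩ := this
  rwa [← smul_right_injective V hx hmf]

/-- An element of `a • M` is a combination, with coefficients in `a`, of elements `g` of `M` all of
whose multiples by elements of `a` are multiples of the given element. -/
theorem Submodule.mem_smul_inf_of_mem_smul {a : Ideal A} (ha : a ≠ ⊥) {M N : Submodule A V}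
    {f : V} (hf : f ∈ a • M)
    (hN : ∀ g ∈ M, (∀ c ∈ a, ∃ e : A, c • g = e • f) → g ∈ N) : f ∈ a • (M ⊓ N) := by
  obtain ⟨b, x, hx, hab⟩ := Ideal.exists_mul_eq_span_singleton ha
  -- For y = c * d the element d • f lies in x • M, say d • f = x • g. For c' in a, c' * d = x * e
  -- gives c' • g = e • f, which is what `hN` asks of g. Then y = x is used and x cancelled.
  have key : ∀ y ∈ a * b, ∃ h ∈ a • (M ⊓ N), y • f = x • h := by
    intro y hy
    refine Submodule.mul_induction_on hy (fun c hc d hd ↦ ?_) ?_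
    · have hdf : d • f ∈ Ideal.span {x} • M := by
        rw [← hab, mul_comm, Submodule.mul_smul]
        exact Submodule.smul_mem_smul hd hf
      rw [Submodule.ideal_span_singleton_smul] at hdf
      obtain ⟨g, hg, hgf⟩ := hdf
      replace hgf : x • g = d • f := hgf
      refine ⟨c • g, Submodule.smul_mem_smul hc ⟨hg, hN g hg fun c' hc' ↦ ?_⟩, ?_⟩
      · have : c' * d ∈ Ideal.span {x} := hab ▸ Ideal.mul_mem_mul hc' hd
        obtain ⟨e, he⟩ := Ideal.mem_span_singleton.1 this
        refine ⟨e, smul_right_injective V hx ?_⟩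
        change x • c' • g = x • e • f
        rw [smul_comm, hgf, smul_smul, he, mul_smul]
      · rw [mul_smul, ← hgf, smul_comm]
    · rintro y z ⟨h, hh, e⟩ ⟨h', hh', e'⟩
      exact ⟨h + h', add_mem hh hh', by rw [add_smul, e, e', smul_add]⟩
  obtain ⟨h, hh, e⟩ := key x (hab ▸ Ideal.mem_span_singleton_self x)
  rwa [smul_right_injective V hx e]

theorem Submodule.smul_inf_of_saturated {a : Ideal A} (ha : a ≠ ⊥) (M : Submodule A V)
    {W : Submodule A V} (hW : ∀ (c : A) (g : V), c ≠ 0 → c • g ∈ W → g ∈ W) :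
    (a • M) ⊓ W = a • (M ⊓ W) := by
  apply le_antisymm
  · rintro f ⟨hf, hfW⟩
    obtain ⟨c, hc, hc0⟩ := Submodule.exists_mem_ne_zero_of_ne_bot ha
    refine mem_smul_inf_of_mem_smul ha hf fun g _ h ↦ ?_
    obtain ⟨e, he⟩ := h c hc
    exact hW c g hc0 (he ▸ W.smul_mem e hfW)
  · exact le_inf (Submodule.smul_mono le_rfl inf_le_left)
      (Submodule.smul_le_right.trans inf_le_right)

end TorsionFree

/-! ### Truncations and ideals of top coefficients -/

namespace Polynomial

variable {A : Type*} [CommRing A]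

/-- The ideal of coefficients at `X ^ j` of the elements of degree at most `j` of a submodule. -/
noncomputable def topCoeffs (M : Submodule A A[X]) (j : ℕ) : Ideal A :=
  (M ⊓ degreeLT A (j + 1)).map (lcoeff A j)

/-- The elements of degree less than `n` of an ideal. -/
noncomputable def truncated (I : Ideal A[X]) (n : ℕ) : Submodule A A[X] :=
  I.restrictScalars A ⊓ degreeLT A n

theorem mem_truncated {I : Ideal A[X]} {n : ℕ} {f : A[X]} :
    f ∈ truncated I n ↔ f ∈ I ∧ f ∈ degreeLT A n := Iff.rfl

theorem mem_topCoeffs {M : Submodule A A[X]} {j : ℕ} {c : A} :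
    c ∈ topCoeffs M j ↔ ∃ f ∈ M, f ∈ degreeLT A (j + 1) ∧ f.coeff j = c := by
  simp [topCoeffs, and_assoc]

theorem topCoeffs_inf_degreeLT (M : Submodule A A[X]) {j n : ℕ} (h : j < n) :
    topCoeffs (M ⊓ degreeLT A n) j = topCoeffs M j := by
  rw [topCoeffs, topCoeffs, inf_assoc, inf_eq_right.2 (degreeLT_mono (Nat.succ_le_of_lt h))]

theorem mem_degreeLT_iff_coeff {n : ℕ} {f : A[X]} :
    f ∈ degreeLT A n ↔ ∀ m, n ≤ m → f.coeff m = 0 := by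
  rw [mem_degreeLT, degree_lt_iff_coeff_zero]

theorem degreeLT_succ_inf_ker (n : ℕ) :
    (degreeLT A (n + 1)) ⊓ LinearMap.ker (lcoeff A n) = degreeLT A n := by
  ext f
  simp only [Submodule.mem_inf, mem_degreeLT_iff_coeff, LinearMap.mem_ker, lcoeff_apply]
  refine ⟨fun h m hm ↦ ?_, fun h ↦ ⟨fun m hm ↦ h m (by omega), h n le_rfl⟩⟩
  rcases hm.eq_or_lt with rfl | hm
  · exact h.2
  · exact h.1 m hm

theorem mem_smul_top_of_coeff_mem {a : Ideal A} {f : A[X]} (h : ∀ n, f.coeff n ∈ a) :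
    f ∈ a • (⊤ : Submodule A A[X]) := by
  rw [f.as_sum_range_C_mul_X_pow]
  refine sum_mem fun n _ ↦ ?_
  rw [← smul_eq_C_mul]
  exact Submodule.smul_mem_smul (h n) trivial

theorem mul_X_sub_mem_truncated {I : Ideal A[X]} {k : ℕ} {u : A[X]} (hu : u.Monic)
    (hk : u.natDegree = k + 1) (hI : u ∈ I) {f : A[X]} (hf : f ∈ truncated I (k + 1)) :
    f * X - C (f.coeff k) * u ∈ truncated I (k + 1) := by
  refine ⟨sub_mem (I.mul_mem_right _ hf.1) (I.mul_mem_left _ hI),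
    mem_degreeLT_iff_coeff.2 fun m hm ↦ ?_⟩
  obtain ⟨m, rfl⟩ : ∃ l, m = l + 1 := ⟨m - 1, by omega⟩
  rw [coeff_sub, coeff_mul_X, coeff_C_mul]
  rcases (Nat.le_of_succ_le_succ hm).eq_or_lt with rfl | h
  · rw [← hk, hu.coeff_natDegree]
    simp
  · rw [mem_degreeLT_iff_coeff.1 hf.2 m h, coeff_eq_zero_of_natDegree_lt (p := u) (by omega)]
    simp

/-- If an ideal contains a monic polynomial of degree `k + 1`, then the coefficients at `X ^ k` of
its elements of degree at most `k` generate all coefficients of these elements. -/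
theorem coeff_mem_topCoeffs {I : Ideal A[X]} {k : ℕ} {u : A[X]} (hu : u.Monic)
    (hk : u.natDegree = k + 1) (hI : u ∈ I) {f : A[X]} (hf : f ∈ truncated I (k + 1)) (n : ℕ) :
    f.coeff n ∈ topCoeffs (I.restrictScalars A) k := by
  by_cases hn : k < n
  · rw [mem_degreeLT_iff_coeff.1 hf.2 n hn]
    exact zero_mem _
  · obtain ⟨j, hj⟩ : ∃ j, n + j = k := ⟨k - n, by omega⟩
    clear hn
    induction j generalizing f n with
    | zero =>
      obtain rfl : n = k := hj
      exact mem_topCoeffs.2 ⟨f, hf.1, hf.2, rfl⟩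
    | succ j ih =>
      -- The coefficient of f * X - f_k u at n + 1 is f_n - f_k u_{n+1}: this moves f_n one place
      -- nearer to the top, up to a multiple of f_k.
      have h := ih (mul_X_sub_mem_truncated hu hk hI hf) (n + 1) (by omega)
      rw [coeff_sub, coeff_mul_X, coeff_C_mul] at h
      have h0 : f.coeff k ∈ topCoeffs (I.restrictScalars A) k :=
        mem_topCoeffs.2 ⟨f, hf.1, hf.2, rfl⟩
      simpa using add_mem h (Ideal.mul_mem_right (u.coeff (n + 1)) _ h0)

theorem mem_degreeLT_of_smul_mem [IsDomain A] {n : ℕ} (c : A) (g : A[X]) (hc : c ≠ 0)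
    (h : c • g ∈ degreeLT A n) : g ∈ degreeLT A n := by
  rw [mem_degreeLT_iff_coeff] at h ⊢
  intro m hm
  simpa [hc] using h m hm

section Dedekind

variable [IsDedekindDomain A]

theorem topCoeffs_smul {a : Ideal A} (ha : a ≠ ⊥) (M : Submodule A A[X]) (j : ℕ) :
    topCoeffs (a • M) j = a * topCoeffs M j := by
  rw [topCoeffs, Submodule.smul_inf_of_saturated ha _ mem_degreeLT_of_smul_mem,
    Submodule.map_smul'']
  rfl

/-- Filter M by degree. Each top coefficient map has as image an ideal c, in which ac has index
N(a). Its kernel is the part of lower degree, and intersecting with that part commutes with a • _ by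
saturation. The hypothesis `h0` allows N(c) to be cancelled. -/
theorem relIndex_smul_of_le_degreeLT [Module.Free ℤ A] {a : Ideal A} (ha : a ≠ ⊥) (n : ℕ)
    {M : Submodule A A[X]} (hM : M ≤ degreeLT A n)
    (h0 : ∀ j < n, (topCoeffs M j).absNorm ≠ 0) :
    (a • M).toAddSubgroup.relIndex M.toAddSubgroup = a.absNorm ^ n := by
  induction n generalizing M with
  | zero =>
    have : M = ⊥ := by
      rw [eq_bot_iff]
      refine hM.trans ?_
      intro f hf
      rw [mem_degreeLT_iff_coeff] at hf
      exact Polynomial.ext fun m ↦ by simpa using hf m (Nat.zero_le m)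
    subst this
    simp
  | succ n ih =>
    have hker : (lcoeff A n).toAddMonoidHom.ker = (LinearMap.ker (lcoeff A n)).toAddSubgroup := rfl
    have hM0 : M ⊓ LinearMap.ker (lcoeff A n) = M ⊓ degreeLT A n := by
      rw [← degreeLT_succ_inf_ker, ← inf_assoc, inf_eq_left.2 hM]
    have haM : (a • M) ⊓ LinearMap.ker (lcoeff A n) = a • (M ⊓ degreeLT A n) := by
      rw [← Submodule.smul_inf_of_saturated ha _ mem_degreeLT_of_smul_mem,
        ← degreeLT_succ_inf_ker, ← inf_assoc, inf_eq_left.2 (Submodule.smul_le_right.trans hM)]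
    have htop : topCoeffs M n = M.map (lcoeff A n) := by
      rw [topCoeffs, inf_eq_left.2 hM]
    rw [AddSubgroup.relIndex_eq_relIndex_inf_ker_mul_relIndex_map (lcoeff A n).toAddMonoidHom
      (Submodule.toAddSubgroup_mono Submodule.smul_le_right), pow_succ]
    congr 1
    · rw [hker]
      have e1 : (a • M).toAddSubgroup ⊓ (LinearMap.ker (lcoeff A n)).toAddSubgroup =
        (a • (M ⊓ degreeLT A n)).toAddSubgroup := by rw [← haM]; rfl
      have e2 : M.toAddSubgroup ⊓ (LinearMap.ker (lcoeff A n)).toAddSubgroup =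
        (M ⊓ degreeLT A n).toAddSubgroup := by rw [← hM0]; rfl
      rw [e1, e2]
      refine ih inf_le_right fun j hj ↦ ?_
      rw [topCoeffs_inf_degreeLT _ hj]
      exact h0 j (hj.trans n.lt_succ_self)
    · have e1 : (a • M).toAddSubgroup.map (lcoeff A n).toAddMonoidHom =
          (a * topCoeffs M n).toAddSubgroup := by
        rw [htop, ← smul_eq_mul, ← Submodule.map_smul'']
        rfl
      have e2 : M.toAddSubgroup.map (lcoeff A n).toAddMonoidHom =
          (topCoeffs M n).toAddSubgroup := by
        rw [htop]; rfl
      rw [e1, e2]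
      have := AddSubgroup.relIndex_mul_index (H := (a * topCoeffs M n).toAddSubgroup)
        (K := (topCoeffs M n).toAddSubgroup) (Submodule.toAddSubgroup_mono Ideal.mul_le_right)
      rw [← Ideal.absNorm_eq_index, ← Ideal.absNorm_eq_index, map_mul] at this
      exact Nat.eq_of_mul_eq_mul_right (Nat.pos_of_ne_zero (h0 n n.lt_succ_self)) this

end Dedekind

/-! ### Ideals containing a monic polynomial -/

/-- The ideal contains a monic polynomial of degree `k`. -/
def HasMonic (I : Ideal A[X]) (k : ℕ) : Prop := ∃ u ∈ I, u.Monic ∧ u.natDegree = k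

/-- The ideal of polynomials all of whose multiples by constants from `a` lie in `I`. -/
noncomputable def constColon (I : Ideal A[X]) (a : Ideal A) : Ideal A[X] := Submodule.colon I (C '' (a : Set A))

/-- The ideal generated by `u` and the multiples of elements of `J` by constants from `a`. -/
noncomputable def spanSupMul (a : Ideal A) (J : Ideal A[X]) (u : A[X]) : Ideal A[X] :=
  Ideal.span {u} ⊔ a.map C * J

theorem mem_constColon {I : Ideal A[X]} {a : Ideal A} {f : A[X]} :
    f ∈ constColon I a ↔ ∀ c ∈ a, c • f ∈ I := by
  simp [constColon, Submodule.mem_colon, smul_eq_C_mul, mul_comm]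

theorem le_constColon (I : Ideal A[X]) (a : Ideal A) : I ≤ constColon I a :=
  Ideal.le_colon

theorem mem_map_C_mul_iff {a : Ideal A} {J : Ideal A[X]} {f : A[X]} :
    f ∈ a.map C * J ↔ f ∈ a • J.restrictScalars A := by
  rw [← Ideal.smul_restrictScalars]
  rfl

theorem self_mem_spanSupMul (a : Ideal A) (J : Ideal A[X]) (u : A[X]) : u ∈ spanSupMul a J u :=
  Ideal.mem_sup_left (Ideal.mem_span_singleton_self u)

theorem modByMonic_mem {J : Ideal A[X]} {u f : A[X]} (hu : u ∈ J) (hf : f ∈ J) : f %ₘ u ∈ J := by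
  rw [modByMonic_eq_sub_mul_div]
  exact sub_mem hf (J.mul_mem_right _ hu)

theorem spanSupMul_le {a : Ideal A} {J : Ideal A[X]} {u : A[X]} (hJ : u ∈ J) :
    spanSupMul a J u ≤ J :=
  sup_le ((Ideal.span_singleton_le_iff_mem _).2 hJ) Ideal.mul_le_right

theorem topCoeffs_truncated {J : Ideal A[X]} {k : ℕ} :
    topCoeffs (truncated J (k + 1)) k = topCoeffs (J.restrictScalars A) k :=
  topCoeffs_inf_degreeLT _ k.lt_succ_self

theorem hasMonic_zero_iff {J : Ideal A[X]} : HasMonic J 0 ↔ J = ⊤ := by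
  rw [Ideal.eq_top_iff_one]
  constructor
  · rintro ⟨v, hv, hm, h0⟩
    rwa [← hm.natDegree_eq_zero.1 h0]
  · intro h
    exact ⟨1, h, monic_one, natDegree_one⟩

/-- The order m of the quotient annihilates it, so m X^j lies in J, and m is nonzero in A. -/
theorem topCoeffs_ne_bot [CharZero A] {J : Ideal A[X]} (hJ : Nat.card (A[X] ⧸ J) ≠ 0) (j : ℕ) :
    topCoeffs (J.restrictScalars A) j ≠ ⊥ := by
  have hmem : ((Nat.card (A[X] ⧸ J) : ℕ) : A) ∈ topCoeffs (J.restrictScalars A) j := by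
    have h1 : ((Nat.card (A[X] ⧸ J) : ℕ) : A[X]) ∈ J := by
      rw [← Ideal.Quotient.eq_zero_iff_mem, map_natCast, ← nsmul_one]
      exact card_nsmul_eq_zero'
    refine mem_topCoeffs.2 ⟨_, J.mul_mem_right (X ^ j) h1, mem_degreeLT_iff_coeff.2 ?_, ?_⟩
    · intro m hm
      rw [← C_eq_natCast, coeff_C_mul_X_pow, if_neg (by omega)]
    · rw [← C_eq_natCast, coeff_C_mul_X_pow, if_pos rfl]
  intro h
  rw [h, Ideal.mem_bot, Nat.cast_eq_zero] at hmem
  exact hJ hmem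

section Nontrivial

variable [Nontrivial A]

theorem modByMonic_mem_degreeLT {u : A[X]} (hu : u.Monic) (f : A[X]) :
    f %ₘ u ∈ degreeLT A u.natDegree := by
  rw [mem_degreeLT, ← degree_eq_natDegree hu.ne_zero]
  exact degree_modByMonic_lt f hu

theorem modByMonic_eq_self_of_mem_degreeLT {u : A[X]} (hu : u.Monic) {f : A[X]}
    (hf : f ∈ degreeLT A u.natDegree) : f %ₘ u = f := by
  rw [modByMonic_eq_self_iff hu, degree_eq_natDegree hu.ne_zero]
  exact mem_degreeLT.1 hf

/-- Taking remainders modulo u is A-linear, kills (u) and preserves J, so the ideal is determined by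
its remainders. -/
theorem mem_spanSupMul {a : Ideal A} {J : Ideal A[X]} {u : A[X]} (hu : u.Monic) (hJ : u ∈ J)
    {f : A[X]} : f ∈ spanSupMul a J u ↔ f %ₘ u ∈ a • truncated J u.natDegree := by
  constructor
  · intro hf
    obtain ⟨g, hg, h, hh, rfl⟩ := Submodule.mem_sup.1 hf
    obtain ⟨q, rfl⟩ := Ideal.mem_span_singleton.1 hg
    rw [add_modByMonic, (modByMonic_eq_zero_iff_dvd hu).2 (dvd_mul_right u q), zero_add]
    refine Submodule.smul_induction_on (mem_map_C_mul_iff.1 hh) (fun c hc m hm ↦ ?_) ?_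
    · rw [smul_modByMonic]
      exact Submodule.smul_mem_smul hc ⟨modByMonic_mem hJ hm, modByMonic_mem_degreeLT hu m⟩
    · intro x y hx hy
      rw [add_modByMonic]
      exact add_mem hx hy
  · intro hf
    rw [← modByMonic_add_div f u]
    refine add_mem (Ideal.mem_sup_right (mem_map_C_mul_iff.2 ?_))
      (Ideal.mul_mem_right _ _ (self_mem_spanSupMul a J u))
    exact Submodule.smul_mono le_rfl inf_le_left hf

theorem truncated_spanSupMul {a : Ideal A} {J : Ideal A[X]} {u : A[X]} (hu : u.Monic)
    (hJ : u ∈ J) :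
    truncated (spanSupMul a J u) u.natDegree = a • truncated J u.natDegree := by
  ext f
  rw [mem_truncated, mem_spanSupMul hu hJ]
  constructor
  · rintro ⟨h, hf⟩
    rwa [modByMonic_eq_self_of_mem_degreeLT hu hf] at h
  · intro h
    have hf : f ∈ degreeLT A u.natDegree := (Submodule.smul_le_right.trans inf_le_right) h
    exact ⟨by rwa [modByMonic_eq_self_of_mem_degreeLT hu hf], hf⟩

theorem sub_mem_degreeLT_of_monic {u v : A[X]} (hu : u.Monic) (hv : v.Monic)
    (h : u.natDegree = v.natDegree) : u - v ∈ degreeLT A u.natDegree := by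
  rw [mem_degreeLT, ← degree_eq_natDegree hu.ne_zero]
  refine degree_sub_lt_left ?_ hu.ne_zero (hu.trans hv.symm)
  rw [degree_eq_natDegree hu.ne_zero, degree_eq_natDegree hv.ne_zero, h]

theorem spanSupMul_eq_iff {a : Ideal A} {J : Ideal A[X]} {u v : A[X]} (hu : u.Monic)
    (hv : v.Monic) (h : u.natDegree = v.natDegree) (huJ : u ∈ J) :
    spanSupMul a J u = spanSupMul a J v ↔ u - v ∈ a • truncated J u.natDegree := by
  constructor
  · intro e
    rw [← truncated_spanSupMul hu huJ]
    exact ⟨sub_mem (self_mem_spanSupMul a J u) (e ▸ self_mem_spanSupMul a J v),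
      sub_mem_degreeLT_of_monic hu hv h⟩
  · intro hm
    have hm' : u - v ∈ a.map C * J :=
      mem_map_C_mul_iff.2 (Submodule.smul_mono le_rfl inf_le_left hm)
    apply le_antisymm
    · refine sup_le ((Ideal.span_singleton_le_iff_mem _).2 ?_) le_sup_right
      simpa using add_mem (self_mem_spanSupMul a J v)
        (Ideal.mem_sup_right (S := Ideal.span {v}) hm')
    · refine sup_le ((Ideal.span_singleton_le_iff_mem _).2 ?_) le_sup_right
      simpa using sub_mem (self_mem_spanSupMul a J u)
        (Ideal.mem_sup_right (S := Ideal.span {u}) hm')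

theorem HasMonic.exists_mem_truncated {J : Ideal A[X]} {k : ℕ} (h : HasMonic J k) :
    ∃ v ∈ truncated J (k + 1), v.coeff k = 1 := by
  obtain ⟨v, hv, hm, rfl⟩ := h
  refine ⟨v, ⟨hv, mem_degreeLT.2 ?_⟩, hm.coeff_natDegree⟩
  rw [ degree_eq_natDegree hm.ne_zero]
  exact_mod_cast Nat.lt_succ_self _

theorem topCoeffs_eq_top_iff {J : Ideal A[X]} {k : ℕ} :
    topCoeffs (J.restrictScalars A) k = ⊤ ↔ HasMonic J k := by
  rw [Ideal.eq_top_iff_one, mem_topCoeffs]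
  constructor
  · rintro ⟨v, hv, hd, h1⟩
    have hle : v.natDegree ≤ k := by
      rw [natDegree_le_iff_coeff_eq_zero]
      exact fun m hm ↦ mem_degreeLT_iff_coeff.1 hd m hm
    exact ⟨v, hv, monic_of_natDegree_le_of_coeff_eq_one k hle h1,
      natDegree_eq_of_le_of_coeff_ne_zero hle (by simp [h1])⟩
  · intro h
    obtain ⟨v, hv, h1⟩ := h.exists_mem_truncated
    exact ⟨v, hv.1, hv.2, h1⟩

theorem HasMonic.succ {J : Ideal A[X]} {k : ℕ} (h : HasMonic J k) : HasMonic J (k + 1) := by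
  obtain ⟨v, hv, hm, rfl⟩ := h
  exact ⟨v * X, J.mul_mem_right _ hv, hm.mul monic_X, by rw [hm.natDegree_mul monic_X]; simp⟩

theorem HasMonic.mono {J : Ideal A[X]} {k l : ℕ} (h : HasMonic J k) (hkl : k ≤ l) :
    HasMonic J l := by
  induction hkl with
  | refl => exact h
  | step _ ih => exact ih.succ

/-- By pigeonhole two powers of X agree modulo J; their difference is monic. -/
theorem exists_hasMonic_of_finite {J : Ideal A[X]} [Finite (A[X] ⧸ J)] : ∃ k, HasMonic J k := by
  obtain ⟨m, n, hmn, h⟩ : ∃ m n : ℕ, m < n ∧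
      Ideal.Quotient.mk J (X ^ m) = Ideal.Quotient.mk J (X ^ n) := by
    obtain ⟨m, n, hne, h⟩ := Finite.exists_ne_map_eq_of_infinite
      (fun n : ℕ ↦ Ideal.Quotient.mk J (X ^ n))
    rcases hne.lt_or_gt with h1 | h1
    · exact ⟨m, n, h1, h⟩
    · exact ⟨n, m, h1, h.symm⟩
  have hd : (X ^ m : A[X]).degree < (X ^ n : A[X]).degree := by
    rw [degree_X_pow, degree_X_pow]
    exact_mod_cast hmn
  exact ⟨_, X ^ n - X ^ m, Ideal.Quotient.eq.1 h.symm,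
    (monic_X_pow n).sub_of_left hd, rfl⟩

end Nontrivial

/-! ### Recovering an ideal from its top coefficients, colon ideal and a monic element -/

section Dedekind

variable [IsDedekindDomain A]

theorem truncated_eq_smul_constColon {I : Ideal A[X]} {k : ℕ} (hI : HasMonic I (k + 1))
    {a : Ideal A} (ha : a ≠ ⊥) (hIa : topCoeffs (I.restrictScalars A) k = a) :
    truncated I (k + 1) = a • truncated (constColon I a) (k + 1) := by
  obtain ⟨u, hu, hm, hk⟩ := hI
  apply le_antisymm
  · intro f hf
    have hfa : f ∈ a • (⊤ : Submodule A A[X]) :=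
      mem_smul_top_of_coeff_mem fun n ↦ hIa ▸ coeff_mem_topCoeffs hm hk hu hf n
    rw [← top_inf_eq (truncated (constColon I a) (k + 1))]
    -- f is a combination, with coefficients in a, of polynomials g with a • g inside A • f, hence
    -- inside I. Such g lie in the colon ideal and inherit the degree bound of f.
    refine Submodule.mem_smul_inf_of_mem_smul ha hfa fun g _ hg ↦ ⟨?_, ?_⟩
    · refine mem_constColon.2 fun c hc ↦ ?_
      obtain ⟨e, he⟩ := hg c hc
      rw [he, smul_eq_C_mul]
      exact I.mul_mem_left _ hf.1
    · obtain ⟨c, hc, hc0⟩ := Submodule.exists_mem_ne_zero_of_ne_bot ha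
      obtain ⟨e, he⟩ := hg c hc
      exact mem_degreeLT_of_smul_mem c g hc0 (he ▸ Submodule.smul_mem _ e hf.2)
  · rw [Submodule.smul_le]
    exact fun c hc g hg ↦ ⟨mem_constColon.1 hg.1 c hc, Submodule.smul_mem _ c hg.2⟩

/-- Top coefficients of `truncated_eq_smul_constColon` give a = a * c, with c those of the colon
ideal. Cancelling a gives c = 1. -/
theorem hasMonic_constColon {I : Ideal A[X]} {k : ℕ} (hI : HasMonic I (k + 1))
    {a : Ideal A} (ha : a ≠ ⊥) (hIa : topCoeffs (I.restrictScalars A) k = a) :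
    HasMonic (constColon I a) k := by
  rw [← topCoeffs_eq_top_iff]
  have h : a = a * topCoeffs ((constColon I a).restrictScalars A) k := by
    conv_lhs => rw [← hIa, ← topCoeffs_truncated, truncated_eq_smul_constColon hI ha hIa,
      topCoeffs_smul ha, topCoeffs_truncated]
  rw [← Ideal.one_eq_top]
  exact (mul_left_cancel₀ ha (by rw [mul_one]; exact h)).symm

theorem eq_spanSupMul {I : Ideal A[X]} {k : ℕ} {u : A[X]} (hu : u ∈ I) (hm : u.Monic)
    (hk : u.natDegree = k + 1) {a : Ideal A} (ha : a ≠ ⊥)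
    (hIa : topCoeffs (I.restrictScalars A) k = a) :
    I = spanSupMul a (constColon I a) u := by
  apply le_antisymm
  · intro f hf
    rw [mem_spanSupMul hm (le_constColon I a hu), hk,
      ← truncated_eq_smul_constColon ⟨u, hu, hm, hk⟩ ha hIa]
    exact ⟨modByMonic_mem hu hf, hk ▸ modByMonic_mem_degreeLT hm f⟩
  · refine sup_le ((Ideal.span_singleton_le_iff_mem _).2 hu) (Ideal.mul_le.2 fun r hr s hs ↦ ?_)
    have : a.map C ≤ Submodule.colon I ((constColon I a : Ideal A[X]) : Set A[X]) := by
      refine Ideal.map_le_iff_le_comap.2 fun c hc ↦ Submodule.mem_colon.2 fun s hs ↦ ?_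
      rw [smul_eq_mul, ← smul_eq_C_mul]
      exact mem_constColon.1 hs c hc
    exact Submodule.mem_colon.1 (this hr) s hs

theorem topCoeffs_spanSupMul {a : Ideal A} (ha : a ≠ ⊥) {J : Ideal A[X]} {k : ℕ}
    (hJ : HasMonic J k) {u : A[X]} (hm : u.Monic) (hk : u.natDegree = k + 1) (huJ : u ∈ J) :
    topCoeffs ((spanSupMul a J u).restrictScalars A) k = a := by
  rw [← topCoeffs_truncated, ← hk, truncated_spanSupMul hm huJ, topCoeffs_smul ha, hk,
    topCoeffs_truncated, topCoeffs_eq_top_iff.2 hJ, Ideal.mul_top]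

theorem constColon_spanSupMul {a : Ideal A} (ha : a ≠ ⊥) {J : Ideal A[X]}
    {u : A[X]} (hm : u.Monic) (huJ : u ∈ J) :
    constColon (spanSupMul a J u) a = J := by
  apply le_antisymm
  · intro f hf
    have h : f %ₘ u ∈ truncated J u.natDegree := by
      refine Submodule.mem_of_forall_smul_mem_smul ha fun c hc ↦ ?_
      rw [← smul_modByMonic, ← mem_spanSupMul hm huJ]
      exact mem_constColon.1 hf c hc
    rw [← modByMonic_add_div f u]
    exact add_mem h.1 (J.mul_mem_right _ huJ)
  · intro f hf
    refine mem_constColon.2 fun c hc ↦ Ideal.mem_sup_right ?_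
    rw [smul_eq_C_mul]
    exact Ideal.mul_mem_mul (Ideal.mem_map_of_mem C hc) hf

/-! ### Indices and sizes of fibres -/

section Norm

variable [Module.Free ℤ A] [Module.Finite ℤ A] [CharZero A]

theorem relIndex_smul_truncated {a : Ideal A} (ha : a ≠ ⊥) {J : Ideal A[X]}
    (hJ : Nat.card (A[X] ⧸ J) ≠ 0) (n : ℕ) :
    (a • truncated J n).toAddSubgroup.relIndex (truncated J n).toAddSubgroup =
      a.absNorm ^ n := by
  refine relIndex_smul_of_le_degreeLT ha n inf_le_right fun j hj ↦ ?_
  rw [truncated, topCoeffs_inf_degreeLT _ hj, ne_eq, Ideal.absNorm_eq_zero_iff]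
  exact topCoeffs_ne_bot hJ j

/-- With I = (u) + aJ and T the part of J of degree less than deg u, J = I + T and I ∩ T = a • T, so
[J : I] = [T : a • T]. -/
theorem card_quotient_spanSupMul {a : Ideal A} (ha : a ≠ ⊥) {J : Ideal A[X]}
    (hJ : Nat.card (A[X] ⧸ J) ≠ 0) {u : A[X]} (hm : u.Monic) (huJ : u ∈ J) :
    Nat.card (A[X] ⧸ spanSupMul a J u) = a.absNorm ^ u.natDegree * Nat.card (A[X] ⧸ J) := by
  have h1 := AddSubgroup.relIndex_mul_index (H := (spanSupMul a J u).toAddSubgroup)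
    (K := J.toAddSubgroup) (Submodule.toAddSubgroup_mono (spanSupMul_le huJ))
  have h2 : (spanSupMul a J u).toAddSubgroup ⊔ (truncated J u.natDegree).toAddSubgroup =
      J.toAddSubgroup := by
    apply le_antisymm
    · exact sup_le (Submodule.toAddSubgroup_mono (spanSupMul_le huJ)) fun f hf ↦ hf.1
    · intro f hf
      rw [← modByMonic_add_div f u, add_comm]
      exact AddSubgroup.add_mem_sup
        (Ideal.mul_mem_right _ _ (self_mem_spanSupMul a J u))
        ⟨modByMonic_mem huJ hf, modByMonic_mem_degreeLT hm f⟩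
  have h3 : (spanSupMul a J u).toAddSubgroup ⊓ (truncated J u.natDegree).toAddSubgroup =
      (a • truncated J u.natDegree).toAddSubgroup := by
    rw [← truncated_spanSupMul hm huJ]
    ext f
    exact ⟨fun h ↦ ⟨h.1, h.2.2⟩, fun h ↦ ⟨h.1, spanSupMul_le huJ h.1, h.2⟩⟩
  rw [← h2, AddSubgroup.relIndex_sup_left, ← AddSubgroup.inf_relIndex_right, h2, h3,
    relIndex_smul_truncated ha hJ] at h1
  exact h1.symm

/-- The ideals which contain a monic polynomial of degree `k + 1`, with given ideal of leading
coefficients in degree `k` and given quotient by this ideal. -/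
def colonFiber (k : ℕ) (a : Ideal A) (J : Ideal A[X]) : Set (Ideal A[X]) :=
  {I | HasMonic I (k + 1) ∧ topCoeffs (I.restrictScalars A) k = a ∧ constColon I a = J}

theorem card_quotient_of_mem_colonFiber {k : ℕ} {a : Ideal A} (ha : a ≠ ⊥) {J : Ideal A[X]}
    (hJ : Nat.card (A[X] ⧸ J) ≠ 0) {I : Ideal A[X]} (hI : I ∈ colonFiber k a J) :
    Nat.card (A[X] ⧸ I) = a.absNorm ^ (k + 1) * Nat.card (A[X] ⧸ J) := by
  obtain ⟨⟨u, hu, hm, hk⟩, hIa, rfl⟩ := hI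
  conv_lhs => rw [eq_spanSupMul hu hm hk ha hIa]
  rw [card_quotient_spanSupMul ha hJ hm (le_constColon I a hu), hk]

theorem card_colonFiber {k : ℕ} {a : Ideal A} (ha : a ≠ ⊥) {J : Ideal A[X]}
    (hJ : Nat.card (A[X] ⧸ J) ≠ 0) (hJk : HasMonic J k) :
    Nat.card (colonFiber k a J) = a.absNorm ^ (k + 1) := by
  rw [← relIndex_smul_truncated ha hJ (k + 1)]
  obtain ⟨u, huJ, hm, hk⟩ := hJk.succ
  have hadd : ∀ m : truncated J (k + 1), (u + m : A[X]).Monic ∧ (u + m : A[X]).natDegree = k + 1 ∧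
      u + m ∈ J := by
    intro m
    have hd : (m : A[X]).degree < u.degree := by
      rw [degree_eq_natDegree hm.ne_zero, hk]
      exact mem_degreeLT.1 m.2.2
    exact ⟨hm.add_of_left hd, by rw [natDegree_add_eq_left_of_degree_lt hd, hk],
      add_mem huJ m.2.1⟩
  have hiff : ∀ m m' : truncated J (k + 1), spanSupMul a J (u + m) = spanSupMul a J (u + m') ↔
      (m - m' : A[X]) ∈ a • truncated J (k + 1) := by
    intro m m'
    rw [spanSupMul_eq_iff (hadd m).1 (hadd m').1 ((hadd m).2.1.trans (hadd m').2.1.symm)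
      (hadd m).2.2, (hadd m).2.1, add_sub_add_left_eq_sub]
  -- With u fixed, the monic elements of J of degree k + 1 are the u + m with m in `truncated J (k +
  -- 1)`. By `hiff` the fibre is the quotient of this module by its multiple by a.
  refine (Nat.card_congr (Equiv.ofBijective (Quotient.lift (s := QuotientAddGroup.leftRel
    ((a • truncated J (k + 1)).toAddSubgroup.addSubgroupOf (truncated J (k + 1)).toAddSubgroup)) (fun m : truncated J (k + 1) ↦
    (⟨spanSupMul a J (u + m), ⟨_, self_mem_spanSupMul a J _, (hadd m).1, (hadd m).2.1⟩,
      topCoeffs_spanSupMul ha hJk (hadd m).1 (hadd m).2.1 (hadd m).2.2,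
      constColon_spanSupMul ha (hadd m).1 (hadd m).2.2⟩ : colonFiber k a J)) ?_) ⟨?_, ?_⟩)).symm
  · intro m m' h
    refine Subtype.ext (Eq.symm ((hiff m' m).2 ?_))
    have := QuotientAddGroup.leftRel_apply.1 h
    rw [AddSubgroup.mem_addSubgroupOf] at this
    simpa [sub_eq_neg_add] using this
  · rintro ⟨m⟩ ⟨m'⟩ h
    apply Quotient.sound
    refine QuotientAddGroup.leftRel_apply.2 ?_
    rw [AddSubgroup.mem_addSubgroupOf]
    have := (hiff m' m).1 (congrArg Subtype.val h).symm
    simpa [sub_eq_neg_add] using this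
  · rintro ⟨I, ⟨v, hv, hvm, hvk⟩, hIa, rfl⟩
    have hvJ := le_constColon I a hv
    refine ⟨Quotient.mk _ ⟨v - u, sub_mem hvJ huJ, ?_⟩, Subtype.ext ?_⟩
    · rw [← hvk]
      exact sub_mem_degreeLT_of_monic hvm hm (hvk.trans hk.symm)
    · change spanSupMul a (constColon I a) (u + (v - u)) = I
      rw [add_sub_cancel]
      exact (eq_spanSupMul hv hvm hvk ha hIa).symm

end Norm

end Dedekind

end Polynomial

open Polynomial Filter Topology

/-! ### Sums over fibres and counting Dirichlet series -/

section FiberSums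

variable {X Y : Type*}

theorem summable_comp_iff_summable_card_mul (π : X → Y) [∀ y, Finite {x // π x = y}] (g : Y → ℂ) :
    Summable (fun x ↦ g (π x)) ↔ Summable (fun y ↦ (Nat.card {x // π x = y} : ℂ) * g y) := by
  rw [← summable_norm_iff (f := fun x ↦ g (π x)),
    ← summable_norm_iff (f := fun y ↦ (Nat.card {x // π x = y} : ℂ) * g y), ← (Equiv.sigmaFiberEquiv π).summable_iff]
  change Summable (fun x ↦ ‖g (π (Equiv.sigmaFiberEquiv π x))‖) ↔ _
  rw [summable_sigma_of_nonneg (fun _ ↦ norm_nonneg _)]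
  have h : ∀ y, (fun x : {x // π x = y} ↦
      ‖g (π (Equiv.sigmaFiberEquiv π ⟨y, x⟩))‖) = fun _ ↦ ‖g y‖ := by
    intro y
    funext x
    simp [Equiv.sigmaFiberEquiv, x.2]
  rw [and_iff_right (fun y ↦ Summable.of_finite)]
  refine summable_congr fun y ↦ ?_
  rw [h y, tsum_const, norm_mul, Complex.norm_natCast, nsmul_eq_mul]

theorem hasSum_comp_iff_hasSum_card_mul (π : X → Y) [∀ y, Finite {x // π x = y}] (g : Y → ℂ)
    (S : ℂ) : HasSum (fun x ↦ g (π x)) S ↔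
      HasSum (fun y ↦ (Nat.card {x // π x = y} : ℂ) * g y) S := by
  have h : ∀ y, HasSum (fun x : {x // π x = y} ↦
      ((fun x ↦ g (π x)) ∘ Equiv.sigmaFiberEquiv π) ⟨y, x⟩)
        ((Nat.card {x // π x = y} : ℂ) * g y) := by
    intro y
    have : (fun x : {x // π x = y} ↦
        ((fun x ↦ g (π x)) ∘ Equiv.sigmaFiberEquiv π) ⟨y, x⟩) = fun _ ↦ g y := by
      funext x
      simp [Equiv.sigmaFiberEquiv, x.2]
    rw [this, ← nsmul_eq_mul, ← tsum_const]
    exact Summable.of_finite.hasSum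
  rw [← (Equiv.sigmaFiberEquiv π).hasSum_iff]
  refine ⟨fun H ↦ H.sigma h, fun H ↦ H.sigma_of_hasSum h ?_⟩
  exact (Equiv.sigmaFiberEquiv π).summable_iff.2
    ((summable_comp_iff_summable_card_mul π g).2 H.summable)

theorem hasSum_mul_of_hasSum {f : X → ℂ} {g : Y → ℂ} {S T : ℂ} (hf : HasSum f S)
    (hg : HasSum g T) : HasSum (fun x : X × Y ↦ f x.1 * g x.2) (S * T) :=
  hf.mul hg (summable_mul_of_summable_norm hf.summable.norm hg.summable.norm)

end FiberSums

section CountingSeries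

variable {T : Type*} (w : T → ℕ)

/-- Weight 0 is the default value for infinite quotients. Discarding it matches the convention that
an `LSeries` ignores index 0. -/
theorem LSeries_term_card_eq (s : ℂ) :
    LSeries.term (fun n ↦ (Nat.card {t // w t = n} : ℂ)) s = fun n ↦
      (Nat.card {t : {t // w t ≠ 0} // w t = n} : ℂ) * (n : ℂ) ^ (-s) := by
  funext n
  rcases eq_or_ne n 0 with rfl | hn
  · have : IsEmpty {t : {t // w t ≠ 0} // w t = 0} := ⟨fun t ↦ t.1.2 t.2⟩
    simp
  · rw [LSeries.term_of_ne_zero hn, Complex.cpow_neg, div_eq_mul_inv]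
    congr 2
    exact Nat.card_congr ⟨fun t ↦ ⟨⟨t.1, fun h ↦ hn (t.2.symm.trans h)⟩, t.2⟩,
      fun t ↦ ⟨t.1.1, t.2⟩, fun _ ↦ rfl, fun _ ↦ rfl⟩

theorem LSeriesHasSum_card_iff [∀ n, Finite {t : {t // w t ≠ 0} // w t = n}] (s S : ℂ) :
    LSeriesHasSum (fun n ↦ (Nat.card {t // w t = n} : ℂ)) s S ↔
      HasSum (fun t : {t // w t ≠ 0} ↦ (w t : ℂ) ^ (-s)) S := by
  rw [LSeriesHasSum, LSeries_term_card_eq]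
  exact (hasSum_comp_iff_hasSum_card_mul (fun t : {t // w t ≠ 0} ↦ w t)
    (fun n ↦ (n : ℂ) ^ (-s)) S).symm

/-- A nonzero constant is not summable over an infinite type. Thus finiteness of the number of
ideals of given index will follow from convergence. -/
theorem finite_fiber_of_summable {s : ℂ}
    (h : Summable (fun t : {t // w t ≠ 0} ↦ (w t : ℂ) ^ (-s))) (n : ℕ) :
    Finite {t : {t // w t ≠ 0} // w t = n} := by
  by_contra hinf
  rw [not_finite_iff_infinite] at hinf
  obtain ⟨t⟩ : Nonempty {t : {t // w t ≠ 0} // w t = n} := inferInstance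
  have hn : n ≠ 0 := t.2 ▸ t.1.2
  have h1 : Summable (fun _ : {t : {t // w t ≠ 0} // w t = n} ↦ (n : ℂ) ^ (-s)) := by
    refine (h.comp_injective (Subtype.val_injective (p := fun t : {t // w t ≠ 0} ↦ w t = n))).congr
      fun t ↦ ?_
    simp [t.2]
  rw [summable_const_iff, Complex.cpow_eq_zero_iff] at h1
  exact hn (Nat.cast_eq_zero.1 h1.1)

theorem norm_weight_cpow (t : {t // w t ≠ 0}) (s : ℂ) :
    ‖(w t : ℂ) ^ (-s)‖ = (w t : ℝ) ^ (-s.re) := by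
  rw [Complex.norm_natCast_cpow_of_pos (Nat.pos_of_ne_zero t.2), Complex.neg_re]

end CountingSeries

open Ideal

/-! ### Convergence of the Dedekind zeta function and of the product -/

namespace NumberField

variable (K : Type*) [Field K] [NumberField K]

theorem finite_absNorm_fiber (n : ℕ) :
    Finite {a : {a : Ideal (𝓞 K) // absNorm a ≠ 0} // absNorm a.1 = n} := by
  have := (finite_setOfPred_absNorm_eq (S := 𝓞 K) n).to_subtype
  exact Finite.of_injective (fun a ↦ (⟨a.1.1, a.2⟩ : {a : Ideal (𝓞 K) | absNorm a = n}))
    fun a b h ↦ Subtype.ext (Subtype.ext (Subtype.mk.inj h))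

theorem LSeriesSummable_card_absNorm {s : ℂ} (hs : 1 < s.re) :
    LSeriesSummable (fun n ↦ (Nat.card {I : Ideal (𝓞 K) // absNorm I = n} : ℂ)) s := by
  refine LSeriesSummable_of_sum_norm_bigO_and_nonneg (r := 1)
    (f := fun n ↦ (Nat.card {I : Ideal (𝓞 K) // absNorm I = n} : ℝ)) ?_
    (fun _ ↦ Nat.cast_nonneg _) zero_le_one hs
  refine Asymptotics.isBigO_of_div_tendsto_nhds (.of_forall fun n hn ↦ ?_)
    (dedekindZeta_residue K) ?_
  · rw [Real.rpow_one, Nat.cast_eq_zero] at hn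
    simp [hn]
  refine ((Ideal.tendsto_norm_le_div_atTop₀ K).comp tendsto_natCast_atTop_atTop).congr fun n ↦ ?_
  simp only [Function.comp_apply, Nat.cast_le, Pi.div_apply, Real.rpow_one, ← Nat.cast_sum]
  congr
  -- The added 1 counts the zero ideal, the only one with `absNorm` equal to 0, and extends the
  -- range of norms to 0, …, n.
  rw [← add_left_inj 1, ← card_norm_le_eq_card_norm_le_add_one,
    show Finset.Icc 1 n = Finset.Ioc 0 n from Finset.Icc_succ_left_eq_Ioc _ _,
    show 1 = Nat.card {I : Ideal (𝓞 K) // absNorm I = 0} by simp [Ideal.absNorm_eq_zero_iff],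
    Finset.sum_Ioc_add_eq_sum_Icc (n.zero_le),
    ← Finset.card_preimage_eq_sum_card_image_eq (fun k _ ↦ finite_setOfPred_absNorm_eq k)]
  simp [Set.coe_eq_subtype]

theorem hasSum_dedekindZeta {s : ℂ} (hs : 1 < s.re) :
    HasSum (fun a : {a : Ideal (𝓞 K) // absNorm a ≠ 0} ↦ (absNorm a.1 : ℂ) ^ (-s))
      (dedekindZeta K s) := by
  have := finite_absNorm_fiber K
  exact (LSeriesHasSum_card_iff (T := Ideal (𝓞 K)) (fun a ↦ absNorm a) s _).1
    (LSeriesSummable_card_absNorm K hs).LSeriesHasSum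

theorem summable_absNorm_rpow {r : ℝ} (hr : 1 < r) :
    Summable (fun a : {a : Ideal (𝓞 K) // absNorm a ≠ 0} ↦ (absNorm a.1 : ℝ) ^ (-r)) := by
  have := (hasSum_dedekindZeta K (s := r) (by simpa using hr)).summable.norm
  refine this.congr fun a ↦ ?_
  exact norm_weight_cpow (T := Ideal (𝓞 K)) (fun a ↦ absNorm a) a r

/-- The unit ideal contributes the 1. Any other ideal has norm at least 2, so j of the j + 1 factors
N(a)^(-Re s) are at most 1/2 each. -/
theorem norm_dedekindZeta_sub_one_le {s : ℂ} (hs : 1 < s.re) (j : ℕ) :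
    ‖dedekindZeta K ((j + 1 : ℕ) * s) - 1‖ ≤ (1 / 2) ^ j *
      ∑' a : {a : Ideal (𝓞 K) // absNorm a ≠ 0}, (absNorm a.1 : ℝ) ^ (-s.re) := by
  classical
  have hre : (((j + 1 : ℕ) : ℂ) * s).re = (j + 1 : ℕ) * s.re := by
    rw [← Complex.ofReal_natCast, Complex.re_ofReal_mul]
  have hj : 1 < (((j + 1 : ℕ) : ℂ) * s).re := by
    rw [hre]
    push_cast
    nlinarith [(Nat.cast_nonneg j : (0 : ℝ) ≤ j)]
  let e : {a : Ideal (𝓞 K) // absNorm a ≠ 0} := ⟨⊤, by simp⟩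
  have h := (hasSum_dedekindZeta K hj).sub (hasSum_ite_eq e 1)
  rw [← h.tsum_eq]
  refine tsum_of_norm_bounded ((summable_absNorm_rpow K hs).hasSum.mul_left _) fun a ↦ ?_
  by_cases hae : a = e
  · subst hae
    simp [e]
  · rw [if_neg hae, sub_zero, norm_weight_cpow (T := Ideal (𝓞 K)) (fun a ↦ absNorm a) a, hre]
    have h2 : 2 ≤ absNorm a.1 := by
      have h1 : absNorm a.1 ≠ 1 := fun h ↦ hae (Subtype.ext (absNorm_eq_one_iff.1 h))
      have h0 := a.2
      omega
    have h2' : (2 : ℝ) ≤ absNorm a.1 := by exact_mod_cast h2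
    have hpos : (0 : ℝ) < absNorm a.1 := by linarith
    have e1 : -(((j + 1 : ℕ) : ℝ) * s.re) = -s.re * j + -s.re := by push_cast; ring
    rw [e1, Real.rpow_add hpos, Real.rpow_mul_natCast hpos.le]
    gcongr
    calc (absNorm a.1 : ℝ) ^ (-s.re) ≤ (absNorm a.1 : ℝ) ^ (-1 : ℝ) :=
          Real.rpow_le_rpow_of_exponent_le (by linarith) (by linarith)
      _ ≤ 1 / 2 := by
          rw [Real.rpow_neg_one, one_div]
          exact inv_anti₀ two_pos h2'

theorem summable_norm_dedekindZeta_sub_one {s : ℂ} (hs : 1 < s.re) :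
    Summable (fun j : ℕ ↦ ‖dedekindZeta K ((j + 1 : ℕ) * s) - 1‖) :=
  Summable.of_nonneg_of_le (fun _ ↦ norm_nonneg _) (norm_dedekindZeta_sub_one_le K hs)
    ((summable_geometric_of_lt_one (by norm_num) (by norm_num)).mul_right _)

end NumberField

/-! ### The recursion in the degree and its limit -/

namespace Polynomial

variable (K : Type*) [Field K]

open NumberField

/-- The ideals of finite index in the polynomial ring over the ring of integers. -/
abbrev FiniteIndexIdeal : Type _ := {I : Ideal (𝓞 K)[X] // Nat.card ((𝓞 K)[X] ⧸ I) ≠ 0}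

variable {K}

/-- The summand of the ideal zeta function at an ideal. -/
noncomputable def zetaTerm (s : ℂ) (I : FiniteIndexIdeal K) : ℂ :=
  (Nat.card ((𝓞 K)[X] ⧸ I.1) : ℂ) ^ (-s)

theorem norm_zetaTerm (s : ℂ) (I : FiniteIndexIdeal K) :
    ‖zetaTerm s I‖ = (Nat.card ((𝓞 K)[X] ⧸ I.1) : ℝ) ^ (-s.re) :=
  norm_weight_cpow (T := Ideal (𝓞 K)[X]) (fun I ↦ Nat.card ((𝓞 K)[X] ⧸ I)) I s

theorem exists_hasMonic (I : FiniteIndexIdeal K) : ∃ k, HasMonic I.1 k :=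
  have : Finite ((𝓞 K)[X] ⧸ I.1) := Nat.finite_of_card_ne_zero I.2
  exists_hasMonic_of_finite

variable [NumberField K]

/-- A finite index ideal containing a monic polynomial of degree `k + 1` determines its ideal of
leading coefficients in degree `k` and its colon ideal by the latter. -/
noncomputable def topCoeffsColon (k : ℕ) (I : {I : FiniteIndexIdeal K // HasMonic I.1 (k + 1)}) :
    {a : Ideal (𝓞 K) // absNorm a ≠ 0} × {I : FiniteIndexIdeal K // HasMonic I.1 k} :=
  have ha : topCoeffs (I.1.1.restrictScalars (𝓞 K)) k ≠ ⊥ := topCoeffs_ne_bot I.1.2 k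
  ⟨⟨topCoeffs (I.1.1.restrictScalars (𝓞 K)) k, fun h ↦ ha (absNorm_eq_zero_iff.1 h)⟩,
    ⟨⟨constColon I.1.1 (topCoeffs (I.1.1.restrictScalars (𝓞 K)) k), by
      have hfin : Finite ((𝓞 K)[X] ⧸ I.1.1) := Nat.finite_of_card_ne_zero I.1.2
      have := Finite.of_surjective _
        (Ideal.Quotient.factor_surjective (le_constColon I.1.1
          (topCoeffs (I.1.1.restrictScalars (𝓞 K)) k)))
      exact Nat.card_pos.ne'⟩, hasMonic_constColon I.2 ha rfl⟩⟩

theorem topCoeffsColon_eq_iff {k : ℕ} (I : {I : FiniteIndexIdeal K // HasMonic I.1 (k + 1)})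
    (y : {a : Ideal (𝓞 K) // absNorm a ≠ 0} × {I : FiniteIndexIdeal K // HasMonic I.1 k}) :
    topCoeffsColon k I = y ↔ I.1.1 ∈ colonFiber k y.1.1 y.2.1.1 := by
  obtain ⟨⟨a, ha⟩, ⟨⟨J, hJ⟩, hJk⟩⟩ := y
  simp only [topCoeffsColon, Prod.mk.injEq, Subtype.mk.injEq, colonFiber, Set.mem_ofPred_eq]
  constructor
  · rintro ⟨rfl, h⟩
    exact ⟨I.2, rfl, h⟩
  · rintro ⟨_, rfl, h⟩
    exact ⟨rfl, h⟩

theorem card_quotient_ne_zero_of_mem_colonFiber {k : ℕ} {a : Ideal (𝓞 K)} (ha : absNorm a ≠ 0)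
    {J : Ideal (𝓞 K)[X]} (hJ : Nat.card ((𝓞 K)[X] ⧸ J) ≠ 0) {I : Ideal (𝓞 K)[X]}
    (hI : I ∈ colonFiber k a J) : Nat.card ((𝓞 K)[X] ⧸ I) ≠ 0 := by
  rw [card_quotient_of_mem_colonFiber (fun h ↦ ha (absNorm_eq_zero_iff.2 h)) hJ hI]
  exact mul_ne_zero (pow_ne_zero _ ha) hJ

theorem card_topCoeffsColon_fiber (k : ℕ)
    (y : {a : Ideal (𝓞 K) // absNorm a ≠ 0} × {I : FiniteIndexIdeal K // HasMonic I.1 k}) :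
    Nat.card {I // topCoeffsColon k I = y} = absNorm y.1.1 ^ (k + 1) := by
  rw [← card_colonFiber (fun h ↦ y.1.2 (absNorm_eq_zero_iff.2 h)) y.2.1.2 y.2.2]
  exact Nat.card_congr
    ⟨fun I ↦ ⟨I.1.1.1, (topCoeffsColon_eq_iff I.1 y).1 I.2⟩,
      fun I ↦ ⟨⟨⟨I.1, card_quotient_ne_zero_of_mem_colonFiber y.1.2 y.2.1.2 I.2⟩, I.2.1⟩,
        (topCoeffsColon_eq_iff _ y).2 I.2⟩, fun _ ↦ rfl, fun _ ↦ rfl⟩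

theorem zetaTerm_eq (s : ℂ) {k : ℕ} (I : {I : FiniteIndexIdeal K // HasMonic I.1 (k + 1)}) :
    zetaTerm s I.1 = (absNorm (topCoeffsColon k I).1.1 : ℂ) ^ (((k + 1 : ℕ) : ℂ) * -s) *
      zetaTerm s (topCoeffsColon k I).2.1 := by
  have h := card_quotient_of_mem_colonFiber
    (fun h ↦ (topCoeffsColon k I).1.2 (absNorm_eq_zero_iff.2 h)) (topCoeffsColon k I).2.1.2
    ((topCoeffsColon_eq_iff I _).1 rfl)
  rw [zetaTerm, h, zetaTerm, Nat.cast_mul, Complex.natCast_mul_natCast_cpow, Nat.cast_pow,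
    Complex.natCast_cpow_natCast_mul]

theorem hasSum_zetaTerm_hasMonic {s : ℂ} (hs : 2 < s.re) (k : ℕ) :
    HasSum (fun I : {I : FiniteIndexIdeal K // HasMonic I.1 k} ↦ zetaTerm s I.1)
      (∏ d ∈ Finset.range k, dedekindZeta K ((d + 1 : ℕ) * (s - 1))) := by
  induction k with
  | zero =>
    have htop : Nat.card ((𝓞 K)[X] ⧸ (⊤ : Ideal (𝓞 K)[X])) = 1 :=
      Nat.card_eq_one_iff_unique.2 ⟨inferInstance, inferInstance⟩
    let _ : Unique {I : FiniteIndexIdeal K // HasMonic I.1 0} :=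
      { default := ⟨⟨⊤, by simp⟩, hasMonic_zero_iff.2 rfl⟩
        uniq := fun I ↦ Subtype.ext (Subtype.ext (hasMonic_zero_iff.1 I.2)) }
    convert hasSum_unique (fun I : {I : FiniteIndexIdeal K // HasMonic I.1 0} ↦ zetaTerm s I.1)
    change _ = ((Nat.card ((𝓞 K)[X] ⧸ (⊤ : Ideal (𝓞 K)[X])) : ℕ) : ℂ) ^ (-s)
    simp
  | succ k ih =>
    have hfin : ∀ y, Finite {I // topCoeffsColon (K := K) k I = y} := fun y ↦
      Nat.finite_of_card_ne_zero (by
        rw [card_topCoeffsColon_fiber]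
        exact pow_ne_zero _ y.1.2)
    have hk : 1 < (((k + 1 : ℕ) : ℂ) * (s - 1)).re := by
      rw [← Complex.ofReal_natCast, Complex.re_ofReal_mul, Complex.sub_re, Complex.one_re]
      push_cast
      nlinarith [(Nat.cast_nonneg k : (0 : ℝ) ≤ k)]
    have hz := hasSum_dedekindZeta K hk
    have hmul := hasSum_mul_of_hasSum hz ih
    rw [Finset.prod_range_succ, mul_comm]
    refine HasSum.congr_fun ?_ (zetaTerm_eq s)
    -- The fibre size N(a)^(k+1) times the term N(a)^(-(k+1)s) is N(a)^(-(k+1)(s-1)): this is the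
    -- source of the shift s - 1.
    refine (hasSum_comp_iff_hasSum_card_mul (topCoeffsColon k) (fun y ↦
      (absNorm y.1.1 : ℂ) ^ (((k + 1 : ℕ) : ℂ) * -s) * zetaTerm s y.2.1) _).2 ?_
    refine HasSum.congr_fun hmul fun y ↦ ?_
    have h0 : (absNorm y.1.1 : ℂ) ≠ 0 := Nat.cast_ne_zero.2 y.1.2
    rw [card_topCoeffsColon_fiber, ← mul_assoc, Nat.cast_pow, ← Complex.cpow_natCast,
      ← Complex.cpow_add _ _ h0]
    congr 2
    ring

theorem multipliable_dedekindZeta {s : ℂ} (hs : 2 < s.re) :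
    Multipliable (fun d : ℕ ↦ dedekindZeta K ((d + 1 : ℕ) * (s - 1))) := by
  have hs' : 1 < (s - 1).re := by
    rw [Complex.sub_re, Complex.one_re]
    linarith
  simpa using multipliable_one_add_of_summable (summable_norm_dedekindZeta_sub_one K hs')

theorem summable_norm_zetaTerm {s : ℂ} (hs : 2 < s.re) :
    Summable (fun I : FiniteIndexIdeal K ↦ ‖zetaTerm s I‖) := by
  have hr : 2 < (s.re : ℂ).re := by simpa using hs
  -- At the real point Re s the terms are their own norms, so bounded partial products bound sums of
  -- norms.
  obtain ⟨B, hB⟩ := (multipliable_dedekindZeta (K := K) hr).tendsto_prod_tprod_nat.norm.bddAbove_range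
  have hterm : ∀ I : FiniteIndexIdeal K, zetaTerm s.re I = (‖zetaTerm s I‖ : ℝ) := by
    intro I
    rw [norm_zetaTerm, zetaTerm, Complex.ofReal_cpow (Nat.cast_nonneg _)]
    simp
  classical
  refine summable_of_sum_le (c := B) (fun _ ↦ norm_nonneg _) fun u ↦ ?_
  choose m hm using exists_hasMonic (K := K)
  -- Finitely many ideals all contain monic polynomials of one common degree, by multiplying with
  -- powers of X.
  set k := u.sup m
  have hu : ∀ I ∈ u, HasMonic I.1 k := fun I hI ↦ (hm I).mono (Finset.le_sup hI)
  have hsum := hasSum_zetaTerm_hasMonic (K := K) hr k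
  have hreal : Summable (fun I : {I : FiniteIndexIdeal K // HasMonic I.1 k} ↦ ‖zetaTerm s I.1‖) := by
    refine hsum.summable.norm.congr fun I ↦ ?_
    rw [hterm, Complex.norm_real, norm_norm]
  calc ∑ I ∈ u, ‖zetaTerm s I‖
      = ∑ I ∈ u.subtype (fun I ↦ HasMonic I.1 k), ‖zetaTerm s I.1‖ := by
        rw [Finset.sum_subtype_of_mem (f := fun I ↦ ‖zetaTerm s I‖) hu]
    _ ≤ ∑' I : {I : FiniteIndexIdeal K // HasMonic I.1 k}, ‖zetaTerm s I.1‖ :=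
        hreal.sum_le_tsum _ fun _ _ ↦ norm_nonneg _
    _ = ‖∏ d ∈ Finset.range k, dedekindZeta K ((d + 1 : ℕ) * (s.re - 1))‖ := by
        rw [← hsum.tsum_eq]
        simp_rw [hterm]
        rw [← Complex.ofReal_tsum, Complex.norm_real, Real.norm_of_nonneg]
        exact tsum_nonneg fun _ ↦ norm_nonneg _
    _ ≤ B := hB ⟨k, rfl⟩

theorem tendsto_prod_dedekindZeta {s : ℂ} (hs : 2 < s.re) :
    Tendsto (fun k ↦ ∏ d ∈ Finset.range k, dedekindZeta K ((d + 1 : ℕ) * (s - 1))) atTop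
      (𝓝 (∑' I : FiniteIndexIdeal K, zetaTerm s I)) := by
  have h : ∀ k, ∏ d ∈ Finset.range k, dedekindZeta K ((d + 1 : ℕ) * (s - 1)) =
      ∑' I : FiniteIndexIdeal K, {I | HasMonic I.1 k}.indicator (zetaTerm s) I := by
    intro k
    rw [← tsum_subtype, ← (hasSum_zetaTerm_hasMonic (K := K) hs k).tsum_eq]
    rfl
  simp_rw [h]
  -- The indicators increase to 1: each ideal enters at some degree and stays from then on.
  refine tendsto_tsum_of_dominated_convergence (summable_norm_zetaTerm (K := K) hs) (fun I ↦ ?_)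
    (.of_forall fun k I ↦ norm_indicator_le_norm_self _ _)
  obtain ⟨m, hm⟩ := exists_hasMonic I
  refine tendsto_const_nhds.congr' ?_
  filter_upwards [eventually_ge_atTop m] with k hk
  rw [Set.indicator_of_mem]
  exact hm.mono hk

theorem hasProd_dedekindZeta {s : ℂ} (hs : 2 < s.re) :
    HasProd (fun d : ℕ ↦ dedekindZeta K ((d + 1 : ℕ) * (s - 1)))
      (∑' I : FiniteIndexIdeal K, zetaTerm s I) := by
  rw [tendsto_nhds_unique (tendsto_prod_dedekindZeta hs)
    (multipliable_dedekindZeta hs).tendsto_prod_tprod_nat]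
  exact (multipliable_dedekindZeta hs).hasProd

theorem finite_card_quotient_fiber (n : ℕ) :
    Finite {I : FiniteIndexIdeal K // Nat.card ((𝓞 K)[X] ⧸ I.1) = n} :=
  finite_fiber_of_summable (T := Ideal (𝓞 K)[X]) (fun I ↦ Nat.card ((𝓞 K)[X] ⧸ I))
    -- Any exponent with real part above 2 would serve.
    (s := 3) (summable_norm_zetaTerm (K := K) (s := 3) (by norm_num)).of_norm n

end Polynomial

theorem theorem1p2 (K : Type*) [Field K] [NumberField K] :
    (∀ n : ℕ, 1 ≤ n → (idealsOfIndex (𝓞 K)[X] n).Finite) ∧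
    ∀ s : ℂ, 2 < s.re →
      LSeriesSummable (fun n ↦ (idealCount (𝓞 K)[X] n : ℂ)) s ∧
      Summable (fun d : ℕ+ ↦ ‖NumberField.dedekindZeta K ((d : ℂ) * (s - 1)) - 1‖) ∧
      HasProd (fun d : ℕ+ ↦ NumberField.dedekindZeta K ((d : ℂ) * (s - 1)))
        (idealZeta (𝓞 K)[X] s) := by
  have hfin := finite_card_quotient_fiber (K := K)
  refine ⟨fun n hn ↦ ?_, fun s hs ↦ ?_⟩
  · have := hfin n
    refine Set.finite_coe_iff.1 (Finite.of_injective (β := {I : FiniteIndexIdeal K //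
      Nat.card ((𝓞 K)[X] ⧸ I.1) = n}) (fun I ↦ ⟨⟨I.1, fun h ↦ ?_⟩, I.2⟩) fun I J h ↦ ?_)
    · exact (Nat.one_le_iff_ne_zero.1 hn) (I.2.symm.trans h)
    · exact Subtype.ext (congrArg (fun I ↦ I.1.1) h)
  · have hsum : LSeriesHasSum (fun n ↦ (idealCount (𝓞 K)[X] n : ℂ)) s
        (∑' I : FiniteIndexIdeal K, zetaTerm s I) :=
      (LSeriesHasSum_card_iff (T := Ideal (𝓞 K)[X]) (fun I ↦ Nat.card ((𝓞 K)[X] ⧸ I)) s _).2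
        (summable_norm_zetaTerm hs).of_norm.hasSum
    -- Reindexing from d ≥ 1 to d - 1 ≥ 0, the indexing used for the sums and products above.
    have hcast : ∀ d : ℕ+, ((d : ℕ) : ℂ) = ((Equiv.pnatEquivNat d + 1 : ℕ) : ℂ) := fun d ↦ by
      rw [Equiv.pnatEquivNat_apply, PNat.natPred_add_one]
    refine ⟨hsum.LSeriesSummable, ?_, ?_⟩
    · simp_rw [hcast]
      refine (Equiv.pnatEquivNat.summable_iff (f := fun d : ℕ ↦
        ‖NumberField.dedekindZeta K ((d + 1 : ℕ) * (s - 1)) - 1‖)).2 ?_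
      refine NumberField.summable_norm_dedekindZeta_sub_one K ?_
      rw [Complex.sub_re, Complex.one_re]
      linarith
    · simp_rw [hcast]
      refine (Equiv.pnatEquivNat.hasProd_iff (f := fun d : ℕ ↦
        NumberField.dedekindZeta K ((d + 1 : ℕ) * (s - 1)))).2 ?_
      rw [show idealZeta (𝓞 K)[X] s = _ from hsum.LSeries_eq]
      exact hasProd_dedekindZeta hs
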